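/- Let $X$ be a set and let $\mathcal U=\{U_{R,r}\subset X\times X\mid R,r>0\}$ be a family of relations. Write $E(x)=\{y\mid (x,y)\in E\}$ and $E(A)=\bigcup_{x\in A}E(x)$ for a relation $E$, and $F\circ E=\{(x,z)\mid\exists y,\ (x,y)\in E,\ (y,z)\in F\}$. Put $E_r=\bigcap_{R>0}U_{R,r}$ for $r>0$, $d(x,y)=\inf\{r>0\mid (x,y)\in E_r\}\in[0,\infty]$ (with $\inf\emptyset=\infty$), and let $x\,E_d^X\,y$ mean $d(x,y)<\infty$. Suppose the following. Hypothesis 1. (i) $\bigcap_{R,r>0}U_{R,r}$ is the diagonal of $X$. (ii) Each $U_{R,r}$ is symmetric. (iii) If $R\le S$, then $U_{S,r}\subset U_{R,r}$ for all $r>0$. (iv) $U_{R,r}=\bigcup_{0<s<r}U_{R,s}$ for all $R,r>0$. (v) There is a function $\phi:(0,\infty)^2\to(0,\infty)$ such that, for all $R,S,r,s>0$: $R\le\phi(R,r)$; if $R\le S$ and $r\le s$, then $\phi(R,r)\le\phi(S,s)$; and $U_{\phi(R,r+s),r}\circ U_{\phi(R,r+s),s}\subset U_{R,r+s}$. Then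 $d$ is a metric with possibly infinite values, $E_d^X$ is an equivalence relation, and the sets $U_{R,r}$ form a base of entourages of a uniformity on $X$. Give $X$ the topology of this uniformity. Hypothesis 2. (i) $X$ is a Polish space. (ii) For all $R,r,s>0$, $x\in X$ and $y\in E_s(x)$, there are $T,t>0$ with $U_{T,t}(y)\subset E_s(U_{R,r}(x))$. (iii) For all $r,s>0$, $x\in X$, $y\in E_s(x)$ and every neighborhood $V$ of $y$, there is a neighborhood $W$ of $y$ with $E_r(W)\cap E_r(E_s(x))\subset E_r(V\cap E_s(x))$. Hypothesis 3. (i) $E_d^X$ has more than one equivalence class. (ii) For all $x,y\in X$ and $R,r>0$, there is $s>0$ with $U_{R,r}(x)\cap E_s(y)\ne\emptyset$. (iii) For all $R,r>0$ and $x\in X$, there are $S,s>0$, a dense subset $\mathcal D$ of $U_{S,s}(x)\cap E_d^X(x)$, and a $d$-dense subset of $\mathcal D$ any two points of which can be joined by a $d$-continuous path in $U_{R,r}(x)$. Hypothesis 4. For every $r>0$ there is a residual set $C\subset X$ such that for all $x,y\in C$ there is $s_0>0$ such that, for all $s>s_0$, the set $E_s(y)\setminus E_r(x)$ is dense in $E_s(y)$.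 Then, for every Polish group $G$ and every Polish $G$-space $Y$ (a Polish space with a continuous action of $G$) with orbit equivalence relation $E^Y_G$, the relation $E_d^X$ is not Borel reducible to $E^Y_G$: there is no Borel map $\theta:X\to Y$ that sends $E_d^X$-equivalent points to $E_G^Y$-equivalent points and induces an injective map $X/E_d^X\to Y/E_G^Y$. -/

import Mathlib

open Set Filter Topology Uniformity

namespace MetricRel

variable {X : Type*}

/-- The target fiber `E(x) = {y | x E y}` of a relation `E`. -/
def fiber (E : SetRel X X) (x : X) : Set X := {y | (x, y) ∈ E}

/-- The basic requirements on a family of relations `U R r`, `R, r > 0`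
(only positive parameters are meaningful). -/
structure IsScaleFamily (U : ℝ → ℝ → SetRel X X) : Prop where
  iInter_eq_diagonal : ∀ x y : X, (∀ R > 0, ∀ r > 0, (x, y) ∈ U R r) ↔ x = y
  symm : ∀ R > 0, ∀ r > 0, ∀ x y : X, (x, y) ∈ U R r → (y, x) ∈ U R r
  anti : ∀ R > 0, ∀ S > 0, R ≤ S → ∀ r > 0, U S r ⊆ U R r
  eq_iUnion : ∀ R > 0, ∀ r > 0, ∀ p : X × X, p ∈ U R r ↔ ∃ s, 0 < s ∧ s < r ∧ p ∈ U R s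
  exists_phi : ∃ φ : ℝ → ℝ → ℝ,
    (∀ R > 0, ∀ r > 0, R ≤ φ R r) ∧
    (∀ R > 0, ∀ S > 0, ∀ r > 0, ∀ s > 0, R ≤ S → r ≤ s → φ R r ≤ φ S s) ∧
    (∀ R > 0, ∀ r > 0, ∀ s > 0, ∀ x y z : X,
      (x, y) ∈ U (φ R (r + s)) s → (y, z) ∈ U (φ R (r + s)) r → (x, z) ∈ U R (r + s))

/-- `E_r = ⋂_{R > 0} U_{R,r}`. -/
def relE (U : ℝ → ℝ → SetRel X X) (r : ℝ) : SetRel X X :=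
  {p | ∀ R > 0, p ∈ U R r}

/-- `d(x, y) = inf {r > 0 | (x, y) ∈ E_r}`, with value `∞` when there is no such `r`. -/
noncomputable def dist (U : ℝ → ℝ → SetRel X X) (x y : X) : ENNReal :=
  ⨅ (r : ℝ) (_ : 0 < r ∧ (x, y) ∈ relE U r), ENNReal.ofReal r

theorem dist_lt_top_iff (U : ℝ → ℝ → SetRel X X) (x y : X) :
    dist U x y < ⊤ ↔ ∃ r, 0 < r ∧ (x, y) ∈ relE U r := by
  simp only [dist, iInf_lt_iff, ENNReal.ofReal_lt_top, exists_prop, and_true]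

/-- The equivalence relation `x E_d y ↔ d(x, y) < ∞`. -/
def distSetoid (U : ℝ → ℝ → SetRel X X) (hU : IsScaleFamily U) : Setoid X where
  r x y := dist U x y < ⊤
  iseqv := by
    refine ⟨fun x => ?_, fun {x y} h => ?_, fun {x y z} h₁ h₂ => ?_⟩
    · exact (dist_lt_top_iff U x x).2
        ⟨1, one_pos, fun R hR => (hU.iInter_eq_diagonal x x).2 rfl R hR 1 one_pos⟩
    · obtain ⟨r, hr, h⟩ := (dist_lt_top_iff U x y).1 h
      exact (dist_lt_top_iff U y x).2 ⟨r, hr, fun R hR => hU.symm R hR r hr x y (h R hR)⟩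
    · obtain ⟨s, hs, hxy⟩ := (dist_lt_top_iff U x y).1 h₁
      obtain ⟨r, hr, hyz⟩ := (dist_lt_top_iff U y z).1 h₂
      obtain ⟨φ, hφ, -, hc⟩ := hU.exists_phi
      refine (dist_lt_top_iff U x z).2 ⟨r + s, add_pos hr hs, fun R hR => ?_⟩
      have hpos : 0 < φ R (r + s) := lt_of_lt_of_le hR (hφ R hR _ (add_pos hr hs))
      exact hc R hR r hr s hs x y z (hxy _ hpos) (hyz _ hpos)

/-- Compatibility of the family with the topology of `X`. -/
structure IsTopCompatible [TopologicalSpace X] (U : ℝ → ℝ → SetRel X X) : Prop where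
  polish : PolishSpace X
  open_image : ∀ R > 0, ∀ r > 0, ∀ s > 0, ∀ x : X, ∀ y ∈ fiber (relE U s) x,
    ∃ T > 0, ∃ t > 0, fiber (U T t) y ⊆ (relE U s).image (fiber (U R r) x)
  local_image : ∀ r > 0, ∀ s > 0, ∀ x : X, ∀ y ∈ fiber (relE U s) x, ∀ V ∈ 𝓝 y,
    ∃ W ∈ 𝓝 y, (relE U r).image W ∩ (relE U r).image (fiber (relE U s) x) ⊆
      (relE U r).image (V ∩ fiber (relE U s) x)

/-- `p` and `q` can be joined by a `d`-continuous path inside the set `A`. -/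
def JoinedIn (U : ℝ → ℝ → SetRel X X) (A : Set X) (p q : X) : Prop :=
  ∃ γ : unitInterval → X, γ 0 = p ∧ γ 1 = q ∧ (∀ t, γ t ∈ A) ∧
    ∀ t, Tendsto (fun u => dist U (γ t) (γ u)) (𝓝 t) (𝓝 0)

/-- The requirements on the family that are used to make `d` turbulent. -/
structure IsTurbulentFamily [TopologicalSpace X] (U : ℝ → ℝ → SetRel X X) : Prop where
  exists_not_rel : ∃ x y : X, ¬ dist U x y < ⊤
  inter_nonempty : ∀ x y : X, ∀ R > 0, ∀ r > 0, ∃ s > 0,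
    (fiber (U R r) x ∩ fiber (relE U s) y).Nonempty
  exists_paths : ∀ R > 0, ∀ r > 0, ∀ x : X, ∃ S > 0, ∃ s > 0, ∃ D : Set X,
    D ⊆ fiber (U S s) x ∩ {y | dist U x y < ⊤} ∧
    fiber (U S s) x ∩ {y | dist U x y < ⊤} ⊆ closure D ∧
    ∃ D' ⊆ D, (∀ p ∈ D, ∀ ε > 0, ∃ q ∈ D', dist U p q < ε) ∧
      ∀ p ∈ D', ∀ q ∈ D', JoinedIn U (fiber (U R r) x) p q

/-- For every `r > 0` and for all `x`, `y` in a residual set, `E_s(y) \ E_r(x)` is dense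
in `E_s(y)` for all large `s`. -/
def HasDenseDifferences [TopologicalSpace X] (U : ℝ → ℝ → SetRel X X) : Prop :=
  ∀ r > 0, ∃ C ∈ residual X, ∀ x ∈ C, ∀ y ∈ C, ∃ s₀ > 0, ∀ s > s₀,
    fiber (relE U s) y ⊆ closure (fiber (relE U s) y \ fiber (relE U r) x)

/-- Borel reducibility `E ≤_B F`: there is an invariant Borel map inducing an injective map
between the quotients. -/
def BorelReducible {X Y : Type*} [TopologicalSpace X] [TopologicalSpace Y]
    (E : Setoid X) (F : Setoid Y) : Prop :=
  ∃ (θ : X → Y) (hθ : ∀ x x' : X, E x x' → F (θ x) (θ x')),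
    @Measurable X Y (borel X) (borel Y) θ ∧
    Function.Injective (Quotient.map (sa := E) (sb := F) θ hθ)

end MetricRel

namespace MetricRel

/-! ### Baire category: hulls, analytic sets, Kuratowski–Ulam, generic continuity. -/

section Category

open TopologicalSpace MeasureTheory

/-! Let `θ` be a Borel reduction to the orbit relation. It is continuous on a countable intersection
of dense open sets `K n`. By Kuratowski–Ulam along the relations `E_s`, together with the Baire
property of analytic sets, for generic `x`, generic `z ∈ E_s(x)` and generic `y ∈ E_s(z)` close to
`x`, one has `θ y = w • θ x` with `w` as near `1` as desired (`eventually_exists_smul_eq`).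
Hypothesis 4, spread to such `z` by `eventually_mem_closure_fiber_inter`, lets `y` also satisfy
`d(x₀, y) > n`. Iterating from a generic `x₀` (`exists_mem_orbit_notMem`) gives convergent sequences
`x n → y` and `h n → h'` with `θ (x n) = h n • θ x₀`, and shrinking neighbourhoods that keep `d(x₀,
y) > n` for every `n`. By continuity `θ y = h' • θ x₀`, although `d(x₀, y) = ∞`: a contradiction. -/

theorem polishSpace_of_isGδ {X : Type*} [TopologicalSpace X] [PolishSpace X] {A : Set X}
    (hA : IsGδ A) : PolishSpace A := by
  obtain ⟨f, hf, rfl⟩ := isGδ_iff_eq_iInter_nat.1 hA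
  have : ∀ n, PolishSpace (f n) := fun n => (hf n).polishSpace
  -- The diagonal map identifies the intersection with a closed subset of a Polish product.
  let j : (⋂ n, f n : Set X) → ∀ n, f n := fun x n => ⟨x, mem_iInter.1 x.2 n⟩
  have hj : Continuous j := by fun_prop
  have hind : IsInducing j := by
    refine IsInducing.of_comp (g := fun p : ∀ n, f n => (p 0 : X)) hj (by fun_prop) ?_
    exact IsInducing.subtypeVal
  have hinj : Function.Injective j := fun x y h =>
    Subtype.ext (congrArg (fun p : ∀ n, f n => (p 0 : X)) h)
  have hrange : range j = ⋂ n, {p : ∀ n, f n | (p n : X) = p 0} := by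
    ext p
    simp only [mem_range, mem_iInter, mem_ofPred_eq]
    constructor
    · rintro ⟨x, rfl⟩ n
      rfl
    · intro h
      exact ⟨⟨p 0, mem_iInter.2 fun n => h n ▸ (p n).2⟩, funext fun n => Subtype.ext (h n).symm⟩
  refine IsClosedEmbedding.polishSpace (f := j) ⟨⟨hind, hinj⟩, ?_⟩
  rw [hrange]
  exact isClosed_iInter fun n => isClosed_eq (by fun_prop) (by fun_prop)

/-- The points at which `A` is locally nonmeagre. -/
def nonmeagreHull {X : Type*} [TopologicalSpace X] (A : Set X) : Set X :=
  {x | ∀ u, IsOpen u → x ∈ u → ¬ IsMeagre (A ∩ u)}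

section Hull

variable {X : Type*} [TopologicalSpace X]

theorem isClosed_nonmeagreHull (A : Set X) : IsClosed (nonmeagreHull A) := by
  rw [← isOpen_compl_iff, isOpen_iff_forall_mem_open]
  intro x hx
  simp only [nonmeagreHull, mem_compl_iff, mem_ofPred_eq, not_forall, not_not] at hx
  obtain ⟨u, hu, hxu, hm⟩ := hx
  exact ⟨u, fun y hy hy' => hy' u hu hy hm, hu, hxu⟩

theorem nonmeagreHull_subset_closure (A : Set X) : nonmeagreHull A ⊆ closure A := by
  intro x hx
  by_contra h
  refine hx _ isClosed_closure.isOpen_compl h ?_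
  rw [(disjoint_compl_right.mono_left subset_closure).inter_eq]
  exact IsMeagre.empty

theorem isMeagre_diff_nonmeagreHull [SecondCountableTopology X] (A : Set X) :
    IsMeagre (A \ nonmeagreHull A) := by
  have h : IsMeagre (⋃ b ∈ {b ∈ countableBasis X | IsMeagre (A ∩ b)}, A ∩ b) :=
    isMeagre_biUnion ((countable_countableBasis X).mono (sep_subset _ _)) fun b hb => hb.2
  refine h.mono ?_
  rintro x ⟨hxA, hx⟩
  simp only [nonmeagreHull, mem_ofPred_eq, not_forall, not_not] at hx
  obtain ⟨u, hu, hxu, hm⟩ := hx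
  obtain ⟨b, hb, hxb, hbu⟩ := (isBasis_countableBasis X).exists_subset_of_mem_open hxu hu
  exact mem_biUnion (x := b) ⟨hb, hm.mono (inter_subset_inter_right A hbu)⟩ ⟨hxA, hxb⟩

/-- The difference `B` has the Baire property, so it equals an open `u` modulo meagre. Almost all of
`u` avoids every hull of `A n`, hence `⋃ n, A n` is meagre in `u`, and no point of its hull lies in
`u`. -/
theorem isMeagre_nonmeagreHull_diff_iUnion [SecondCountableTopology X] (A : ℕ → Set X) :
    IsMeagre (nonmeagreHull (⋃ n, A n) \ ⋃ n, nonmeagreHull (A n)) := by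
  set B := nonmeagreHull (⋃ n, A n) \ ⋃ n, nonmeagreHull (A n) with hB
  have hBP : BaireMeasurableSet B := by
    refine BaireMeasurableSet.diff ?_ (BaireMeasurableSet.iUnion fun n => ?_)
    · exact ((isClosed_nonmeagreHull _).isOpen_compl.baireMeasurableSet).of_compl
    · exact ((isClosed_nonmeagreHull _).isOpen_compl.baireMeasurableSet).of_compl
  obtain ⟨u, hu, hBu⟩ := hBP.residualEq_isOpen
  have hmeagre : IsMeagre (⋃ n, A n \ nonmeagreHull (A n)) :=
    isMeagre_iUnion fun n => isMeagre_diff_nonmeagreHull (A n)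
  have hAu : IsMeagre ((⋃ n, A n) ∩ u) := by
    change _ ∈ residual X
    filter_upwards [hmeagre, hBu] with x hx hx' hxA
    have hxB : x ∈ B := hx'.mpr hxA.2
    obtain ⟨n, hn⟩ := mem_iUnion.1 hxA.1
    exact hx (mem_iUnion.2 ⟨n, hn, fun h => hxB.2 (mem_iUnion.2 ⟨n, h⟩)⟩)
  change _ ∈ residual X
  filter_upwards [hBu] with x hx hxB
  exact hxB.1 u hu (hx.mp hxB) hAu

open PiNat in
/-- **Lusin–Sierpiński**: analytic sets have the Baire property. -/
theorem baireMeasurableSet_of_analyticSet [T3Space X] [SecondCountableTopology X] {s : Set X}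
    (hs : AnalyticSet s) : BaireMeasurableSet s := by
  rw [AnalyticSet] at hs
  obtain rfl | ⟨f, hf, rfl⟩ := hs
  · exact isOpen_empty.baireMeasurableSet
  -- Images of cylinders; `res` lists the initial coordinates in reverse, so the children of `σ` are
  -- `k :: σ`.
  let A : List ℕ → Set X := fun σ => f '' {y | res y σ.length = σ}
  have hA0 : A [] = range f := by simp [A]
  have hA : ∀ σ, A σ = ⋃ k, A (k :: σ) := by
    intro σ
    ext x
    simp only [A, mem_image, mem_ofPred_eq, mem_iUnion, List.length_cons, res_succ,
      List.cons.injEq]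
    constructor
    · rintro ⟨y, hy, rfl⟩
      exact ⟨y σ.length, y, ⟨rfl, hy⟩, rfl⟩
    · rintro ⟨k, y, ⟨-, hy⟩, rfl⟩
      exact ⟨y, hy, rfl⟩
  have hM : IsMeagre (⋃ σ, nonmeagreHull (A σ) \ ⋃ k, nonmeagreHull (A (k :: σ))) := by
    refine isMeagre_iUnion fun σ => ?_
    conv => enter [1, 1]; rw [hA σ]
    exact isMeagre_nonmeagreHull_diff_iUnion _
  have hcl : BaireMeasurableSet (nonmeagreHull (range f)) :=
    ((isClosed_nonmeagreHull _).isOpen_compl.baireMeasurableSet).of_compl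
  refine hcl.congr ?_
  rw [eventuallyEq_set]
  filter_upwards [hM, isMeagre_diff_nonmeagreHull (range f)] with x hx hx'
  refine ⟨fun hxD => ?_, fun hxf => by_contra fun h => hx' ⟨hxf, h⟩⟩
  -- Off the meagre set, membership in a hull passes to some child. This yields a branch `y` whose
  -- cylinder images all have `x` in their closure, and continuity of `f` at `y` forces `f y = x`.
  have hstep : ∀ σ, x ∈ nonmeagreHull (A σ) → ∃ k, x ∈ nonmeagreHull (A (k :: σ)) := by
    intro σ hσ
    by_contra h
    exact hx (mem_iUnion.2 ⟨σ, hσ, fun h' => h (mem_iUnion.1 h')⟩)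
  choose! k hk using hstep
  let L : ℕ → List ℕ := fun n => Nat.rec [] (fun _ σ => k σ :: σ) n
  have hL : ∀ n, x ∈ nonmeagreHull (A (L n)) := by
    intro n
    induction n with
    | zero => exact hA0.symm ▸ hxD
    | succ n ih => exact hk _ ih
  let y : ℕ → ℕ := fun n => k (L n)
  have hy : ∀ n, res y n = L n := by
    intro n
    induction n with
    | zero => rfl
    | succ n ih => rw [res_succ, ih]
  have hcyl : ∀ n, x ∈ closure (f '' cylinder y n) := by
    intro n
    have h := nonmeagreHull_subset_closure _ (hL n)
    rw [← hy n] at h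
    simpa only [A, res_length, cylinder_eq_res] using h
  refine ⟨y, ?_⟩
  by_contra hne
  obtain ⟨t, ht, htc, htx⟩ := exists_mem_nhds_isClosed_subset
    (isOpen_compl_singleton.mem_nhds (show f y ∈ ({x}ᶜ : Set X) from hne))
  obtain ⟨u, ⟨z, n, rfl⟩, hyu, hu⟩ := (isTopologicalBasis_cylinders (fun _ : ℕ => ℕ)).mem_nhds_iff.1
    (hf.continuousAt.preimage_mem_nhds ht)
  rw [mem_cylinder_iff_eq] at hyu
  rw [← hyu] at hu
  exact htx (closure_minimal (image_subset_iff.2 hu) htc (hcyl n)) rfl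

end Hull

/-- **Kuratowski–Ulam** for a relation whose projection to the first factor is open. -/
theorem eventually_residual_fiber {X : Type*} [TopologicalSpace X] [SecondCountableTopology X]
    {E : SetRel X X} (hE : ∀ v : Set X, IsOpen v → IsOpen {x | ∃ y ∈ v, (x, y) ∈ E})
    {Q : X → X → Prop} (h : ∀ᶠ p : E in residual E, Q p.1.1 p.1.2) :
    ∀ᶠ x in residual X, ∀ᶠ y : fiber E x in residual (fiber E x), Q x y := by
  obtain ⟨S, hSo, hSd, hSc, hSQ⟩ := mem_residual_iff.1 h
  have key : ∀ t ∈ S, ∀ b ∈ countableBasis X, ∀ᶠ x in residual X,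
      (∃ y ∈ b, (x, y) ∈ E) → ∃ y ∈ b, ∃ hxy : (x, y) ∈ E, (⟨(x, y), hxy⟩ : E) ∈ t := by
    intro t ht b hb
    have hbo := isOpen_of_mem_countableBasis hb
    obtain ⟨t', ht', rfl⟩ := isOpen_induced_iff.1 (hSo t ht)
    let O := {x | ∃ y ∈ b, (x, y) ∈ E}
    let N := {x | ∃ y ∈ b, (x, y) ∈ E ∧ (x, y) ∈ t'}
    have hN : IsOpen N := by
      rw [isOpen_iff_mem_nhds]
      rintro x ⟨y, hyb, hxy, hyt⟩
      obtain ⟨u, v, hu, hv, hxu, hyv, huv⟩ := isOpen_prod_iff.1 ht' x y hyt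
      filter_upwards [hu.mem_nhds hxu,
        (hE (b ∩ v) (hbo.inter hv)).mem_nhds ⟨y, ⟨hyb, hyv⟩, hxy⟩] with x' hx' ⟨y', hy', hxy'⟩
      exact ⟨y', hy'.1, hxy', huv ⟨hx', hy'.2⟩⟩
    -- Density of `t` in `E` makes `N` dense in `O`; the exterior of `O` handles fibers missing `b`.
    have hd : Dense (N ∪ (closure O)ᶜ) := by
      rw [dense_iff_inter_open]
      rintro w hw ⟨x, hxw⟩
      by_cases hwO : (w ∩ O).Nonempty
      · obtain ⟨x, hxw, y, hyb, hxy⟩ := hwO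
        obtain ⟨p, hp, hpt⟩ := (hSd _ ht).inter_open_nonempty (Subtype.val ⁻¹' (w ×ˢ b))
          ((hw.prod hbo).preimage continuous_subtype_val) ⟨⟨(x, y), hxy⟩, hxw, hyb⟩
        exact ⟨p.1.1, hp.1, Or.inl ⟨p.1.2, hp.2, p.2, hpt⟩⟩
      · refine ⟨x, hxw, Or.inr fun hx => hwO ?_⟩
        exact mem_closure_iff.1 hx w hw hxw
    filter_upwards [residual_of_dense_open (hN.union isClosed_closure.isOpen_compl) hd] with x hx hxO
    obtain ⟨y, hyb, hxy, hyt⟩ | hx := hx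
    · exact ⟨y, hyb, hxy, hyt⟩
    · exact absurd (subset_closure (show x ∈ O from hxO)) hx
  have key' := (eventually_countable_ball hSc).2 fun t ht =>
    (eventually_countable_ball (countable_countableBasis X)).2 (key t ht)
  filter_upwards [key'] with x hx
  have hres : ∀ t ∈ S, ∀ᶠ y : fiber E x in residual (fiber E x), (⟨(x, y), y.2⟩ : E) ∈ t := by
    intro t ht
    refine residual_of_dense_open ((hSo t ht).preimage (by fun_prop)) ?_
    rw [dense_iff_inter_open]
    rintro w hw ⟨y, hyw⟩
    obtain ⟨w', hw', rfl⟩ := isOpen_induced_iff.1 hw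
    obtain ⟨b, hb, hyb, hbw⟩ := (isBasis_countableBasis X).exists_subset_of_mem_open hyw hw'
    obtain ⟨z, hzb, hxz, hzt⟩ := hx t ht b hb ⟨y, hyb, y.2⟩
    exact ⟨⟨z, hxz⟩, hbw hzb, hzt⟩
  filter_upwards [(eventually_countable_ball hSc).2 hres] with y hy
  exact hSQ (mem_sInter.2 hy)

/-- Preimages of basic open sets are open modulo meagre. The dense `Gδ` is given as a sequence of
open sets so that the construction can enter one at each stage. -/
theorem exists_continuousOn_iInter_dense {X Y : Type*} [TopologicalSpace X] [BaireSpace X]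
    [MeasurableSpace X] [BorelSpace X] [TopologicalSpace Y] [SecondCountableTopology Y]
    [MeasurableSpace Y] [OpensMeasurableSpace Y] {θ : X → Y} (hθ : Measurable θ) :
    ∃ K : ℕ → Set X, (∀ n, IsOpen (K n)) ∧ (∀ n, Dense (K n)) ∧ ContinuousOn θ (⋂ n, K n) := by
  have h : ∀ b ∈ countableBasis Y, ∃ u : Set X, IsOpen u ∧ θ ⁻¹' b =ᵇ u := fun b hb =>
    (hθ (isOpen_of_mem_countableBasis hb).measurableSet).residualEq_isOpen
  choose! u huo hu using h
  obtain ⟨t, ht, htd, htu⟩ := eventually_residual.1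
    ((eventually_countable_ball (countable_countableBasis Y)).2 fun b hb =>
      eventuallyEq_set.1 (hu b hb))
  obtain ⟨K, hK, rfl⟩ := isGδ_iff_eq_iInter_nat.1 ht
  refine ⟨K, hK, fun n => htd.mono (iInter_subset K n), fun x hx => ?_⟩
  rw [ContinuousWithinAt, (isBasis_countableBasis Y).nhds_hasBasis.tendsto_right_iff]
  rintro b ⟨hb, hxb⟩
  filter_upwards [self_mem_nhdsWithin,
    mem_nhdsWithin_of_mem_nhds ((huo b hb).mem_nhds ((htu x hx b hb).1 hxb))] with y hy hyu
  exact (htu y hy b hb).2 hyu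

end Category

/-! ### Generic points along open relations, and small group elements. -/

section OpenRelations

open TopologicalSpace MeasureTheory

variable {X : Type*} [TopologicalSpace X]

/-- Symmetric relations under which images of open sets are open. -/
structure IsOpenRel (E : SetRel X X) : Prop where
  symm : ∀ x y, (x, y) ∈ E → (y, x) ∈ E
  isOpen_image : ∀ v : Set X, IsOpen v → IsOpen (SetRel.image E v)

variable {E : SetRel X X}

theorem IsOpenRel.isOpen_preimage (hE : IsOpenRel E) (v : Set X) (hv : IsOpen v) :
    IsOpen {x | ∃ y ∈ v, (x, y) ∈ E} := by
  convert hE.isOpen_image v hv using 1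
  ext x
  exact exists_congr fun y => and_congr_right fun _ => ⟨hE.symm _ _, hE.symm _ _⟩

theorem IsOpenRel.isOpenMap_snd (hE : IsOpenRel E) : IsOpenMap (fun p : E => p.1.2) := by
  intro w hw
  obtain ⟨w', hw', rfl⟩ := isOpen_induced_iff.1 hw
  rw [isOpen_iff_mem_nhds]
  rintro _ ⟨⟨⟨x, y⟩, hxy⟩, hp, rfl⟩
  obtain ⟨u, v, hu, hv, hxu, hyv, huv⟩ := isOpen_prod_iff.1 hw' x y hp
  filter_upwards [hv.mem_nhds hyv, (hE.isOpen_image u hu).mem_nhds ⟨x, hxu, hxy⟩] with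
    y' hy' ⟨x', hx', hxy'⟩
  exact ⟨⟨(x', y'), hxy'⟩, huv ⟨hx', hy'⟩, rfl⟩

/-- The second projection of `E` is open, so `P` pulls back to a residual subset of `E`, to which
Kuratowski–Ulam applies. -/
theorem IsOpenRel.eventually_fiber [SecondCountableTopology X] (hE : IsOpenRel E) {P : X → Prop}
    (h : ∀ᶠ x in residual X, P x) :
    ∀ᶠ x in residual X, ∀ᶠ y : fiber E x in residual (fiber E x), P y :=
  eventually_residual_fiber hE.isOpen_preimage (Q := fun _ y => P y)
    ((tendsto_residual_of_isOpenMap (by fun_prop) hE.isOpenMap_snd).eventually h)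

theorem IsOpenRel.eventually_fiber_swap [SecondCountableTopology X] (hE : IsOpenRel E)
    {Q : X → X → Prop} (h : ∀ᶠ p : E in residual E, Q p.1.1 p.1.2) :
    ∀ᶠ x in residual X, ∀ᶠ y : fiber E x in residual (fiber E x), Q y x := by
  refine eventually_residual_fiber hE.isOpen_preimage (Q := fun x y => Q y x) ?_
  let σ : E ≃ₜ E :=
    { toFun := fun p => ⟨(p.1.2, p.1.1), hE.symm _ _ p.2⟩
      invFun := fun p => ⟨(p.1.2, p.1.1), hE.symm _ _ p.2⟩
      left_inv := fun _ => rfl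
      right_inv := fun _ => rfl
      continuous_toFun := by fun_prop
      continuous_invFun := by fun_prop }
  exact (tendsto_residual_of_isOpenMap σ.continuous σ.isOpenMap).eventually h

/-- Iterating "holds at generic fiber points" and intersecting the countably many conditions gives a
generic set that can be re-entered along fibers indefinitely. -/
theorem exists_hereditary [SecondCountableTopology X] {E : ℕ → SetRel X X}
    (hE : ∀ n, IsOpenRel (E n)) {P : X → Prop} (h : ∀ᶠ x in residual X, P x) :
    ∃ M ∈ residual X, (∀ x ∈ M, P x) ∧
      ∀ x ∈ M, ∀ n, ∀ᶠ y : fiber (E n) x in residual (fiber (E n) x), (y : X) ∈ M := by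
  let P' : ℕ → X → Prop := fun k => Nat.rec P
    (fun _ R x => ∀ n, ∀ᶠ y : fiber (E n) x in residual (fiber (E n) x), R y) k
  have hP' : ∀ k, ∀ᶠ x in residual X, P' k x := by
    intro k
    induction k with
    | zero => exact h
    | succ k ih => exact eventually_countable_forall.2 fun n => (hE n).eventually_fiber ih
  refine ⟨{x | ∀ k, P' k x}, eventually_countable_forall.2 hP', fun x hx => hx 0,
    fun x hx n => eventually_countable_forall.2 fun k => hx (k + 1) n⟩

theorem nonempty_inter_of_eventually [PolishSpace X] {A : Set X} (hA : IsGδ A) {P : X → Prop}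
    (h : ∀ᶠ x : A in residual A, P x) {u : Set X} (hu : IsOpen u) (hne : (A ∩ u).Nonempty) :
    ∃ x ∈ A, x ∈ u ∧ P x := by
  have := polishSpace_of_isGδ hA
  obtain ⟨x, hxA, hxu⟩ := hne
  obtain ⟨y, hyu, hy⟩ := (dense_of_mem_residual h).inter_open_nonempty (Subtype.val ⁻¹' u)
    (hu.preimage continuous_subtype_val) ⟨⟨x, hxA⟩, hxu⟩
  exact ⟨y, y.2, hyu, hy⟩

theorem isGδ_fiber (hE : IsGδ E) (x : X) : IsGδ (fiber E x) :=
  hE.preimage (f := fun y => (x, y)) (by fun_prop)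

/-- If `F` is dense in `E(x)`, then `x` is in the closure of `E(z) ∩ F` for generic `z ∈ E(x)`. -/
theorem eventually_mem_closure_fiber_inter [SecondCountableTopology X] (hE : IsOpenRel E)
    {x : X} (hx : (x, x) ∈ E)
    (hloc : ∀ y ∈ fiber E x, ∀ v ∈ 𝓝 y, ∃ w ∈ 𝓝 y,
      SetRel.image E w ∩ SetRel.image E (fiber E x) ⊆ SetRel.image E (v ∩ fiber E x))
    {F : Set X} (hF : IsOpen F) (hd : fiber E x ⊆ closure (fiber E x ∩ F)) :
    ∀ᶠ z : fiber E x in residual (fiber E x), x ∈ closure (fiber E z ∩ F) := by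
  have key : ∀ b ∈ countableBasis X, ∀ᶠ z : fiber E x in residual (fiber E x),
      x ∈ b → ∃ y ∈ b ∩ F, ((z : X), y) ∈ E := by
    intro b hb
    by_cases hxb : x ∈ b
    swap
    · exact Eventually.of_forall fun z h => absurd h hxb
    have hbo := isOpen_of_mem_countableBasis hb
    have ho : IsOpen {z : fiber E x | ∃ y ∈ b ∩ F, ((z : X), y) ∈ E} :=
      (hE.isOpen_preimage (b ∩ F) (hbo.inter hF)).preimage continuous_subtype_val
    refine mem_of_superset (residual_of_dense_open ho ?_) fun z hz _ => hz
    rw [dense_iff_inter_open]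
    rintro v hv ⟨z, hzv⟩
    obtain ⟨v', hv', rfl⟩ := isOpen_induced_iff.1 hv
    -- The open set `E(w')` contains `x`, so density yields `y ∈ E(x) ∩ F` in it, near `x`. Since `x
    -- ∈ E(x)`, also `y ∈ E(E(x))`, and the local condition moves the source of `y` into `v' ∩
    -- E(x)`.
    obtain ⟨w, hw, hsub⟩ := hloc z z.2 v' (hv'.mem_nhds hzv)
    obtain ⟨w', hw', hwo, hzw⟩ := mem_nhds_iff.1 hw
    obtain ⟨y, ⟨hyb, hyw⟩, hxy, hyF⟩ := mem_closure_iff.1 (hd hx)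
      (b ∩ SetRel.image E w') (hbo.inter (hE.isOpen_image w' hwo))
      ⟨hxb, z, hzw, hE.symm _ _ z.2⟩
    obtain ⟨q, hqw, hqy⟩ := hyw
    obtain ⟨z', ⟨hz', hxz'⟩, hzy⟩ := hsub ⟨⟨q, hw' hqw, hqy⟩, ⟨x, hx, hxy⟩⟩
    exact ⟨⟨z', hxz'⟩, hz', y, ⟨hyb, hyF⟩, hzy⟩
  filter_upwards [(eventually_countable_ball (countable_countableBasis X)).2 key] with z hz
  rw [(isBasis_countableBasis X).mem_closure_iff]
  intro b hb hxb
  obtain ⟨y, ⟨hyb, hyF⟩, hzy⟩ := hz b hb hxb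
  exact ⟨y, hyb, hzy, hyF⟩

/-- A Borel map sending `E`-related points to one orbit of a Polish group moves points by small
group elements along generic points of `E(z)` close to a generic point `x ∈ E(z)`. -/
theorem eventually_exists_smul_eq [PolishSpace X] [MeasurableSpace X] [BorelSpace X]
    (hE : IsOpenRel E) (hEG : IsGδ E)
    {G : Type*} [Group G] [TopologicalSpace G] [IsTopologicalGroup G] [PolishSpace G]
    {Y : Type*} [TopologicalSpace Y] [PolishSpace Y] [MeasurableSpace Y] [BorelSpace Y]
    [MulAction G Y] [ContinuousSMul G Y]
    {θ : X → Y} (hθ : Measurable θ) (hom : ∀ x y, (x, y) ∈ E → ∃ g : G, g • θ y = θ x)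
    {W : Set G} (hW : W ∈ 𝓝 1) :
    ∀ᶠ x in residual X, ∀ᶠ z : fiber E x in residual (fiber E x), ∃ O ∈ 𝓝 x,
      ∀ᶠ y : fiber E z in residual (fiber E z), (y : X) ∈ O → ∃ w ∈ W,
        θ y = w • θ x := by
  borelize G
  have := polishSpace_of_isGδ hEG
  obtain ⟨V, hV, hVW⟩ := exists_nhds_split_inv hW
  obtain ⟨V', hV', hVo, hV1⟩ := mem_nhds_iff.1 hV
  let g := denseSeq G
  -- Projections along `G` of Borel sets, hence analytic. Modulo meagre they are open, which gives
  -- the neighbourhood of `x`.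
  let S : ℕ → Set E := fun n => {p | ∃ v ∈ V', θ p.1.1 = v • g n • θ p.1.2}
  have hS : ∀ n, AnalyticSet (S n) := by
    intro n
    have hm : MeasurableSet {q : E × G | q.2 ∈ V' ∧ θ q.1.1.1 = q.2 • g n • θ q.1.1.2} := by
      refine (measurable_snd hVo.measurableSet).inter (measurableSet_eq_fun ?_ ?_)
      · exact hθ.comp (by fun_prop)
      · have h2 : Measurable fun q : E × G => g n • θ q.1.1.2 :=
          (continuous_const_smul (g n)).measurable.comp (hθ.comp (by fun_prop))
        exact (continuous_smul (M := G) (X := Y)).measurable.comp (measurable_snd.prodMk h2)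
    convert! hm.analyticSet_image measurable_fst using 1
    ext p
    simp [S]
  choose Ω hΩo hΩ using fun n => (baireMeasurableSet_of_analyticSet (hS n)).residualEq_isOpen
  let A : X → X → Prop := fun x z => ∀ h : (x, z) ∈ E, ∀ n,
    (⟨(x, z), h⟩ : E) ∈ S n ↔ (⟨(x, z), h⟩ : E) ∈ Ω n
  have hA : ∀ᶠ p : E in residual E, A p.1.1 p.1.2 :=
    (eventually_countable_forall.2 fun n => eventuallyEq_set.1 (hΩ n)).mono fun p hp _ n => hp n
  filter_upwards [eventually_residual_fiber hE.isOpen_preimage hA,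
    hE.eventually_fiber (hE.eventually_fiber_swap hA)] with x hx₁ hx₂
  filter_upwards [hx₁, hx₂] with z hz₁ hz₂
  obtain ⟨k, hk⟩ := hom x z z.2
  -- Choose `g n` in the open set `V'⁻¹ * k`, so that `k = v * g n` with `v ∈ V'`.
  obtain ⟨-, ⟨v, hv, rfl⟩, n, hn⟩ := (denseRange_denseSeq G).inter_open_nonempty
    ((fun v => v⁻¹ * k) '' V')
    (by
      convert! hVo.preimage (f := fun a : G => k * a⁻¹) (by fun_prop) using 1
      ext a
      constructor
      · rintro ⟨v, hv, rfl⟩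
        simpa using hv
      · intro ha
        exact ⟨_, ha, by simp⟩) ⟨_, mem_image_of_mem _ hV1⟩
  have hxz : θ x = v • g n • θ z := by
    rw [← hk, smul_smul, show g n = v⁻¹ * k from hn, mul_inv_cancel_left]
  have hxΩ := (hz₁ z.2 n).1 ⟨v, hv, hxz⟩
  obtain ⟨Ω', hΩ'o, hΩ'⟩ := isOpen_induced_iff.1 (hΩo n)
  rw [← hΩ'] at hxΩ
  refine ⟨(fun y => (y, (z : X))) ⁻¹' Ω', (hΩ'o.preimage (by fun_prop)).mem_nhds hxΩ, ?_⟩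
  filter_upwards [hz₂] with y hy hyO
  have hyS : (⟨(y, z), hE.symm _ _ y.2⟩ : E) ∈ S n := by
    rw [hy (hE.symm _ _ y.2) n, ← hΩ']
    exact hyO
  obtain ⟨v', hv', hyz⟩ := hyS
  -- Both `θ y` and `θ x` are `V'`-translates of the same point `g n • θ z`.
  refine ⟨v' / v, hVW v' (hV' hv') v (hV' hv), ?_⟩
  rw [hxz, smul_smul, div_mul_cancel]
  exact hyz

end OpenRelations

/-! ### The convergent construction inside one orbit. -/

section Construction

open TopologicalSpace MeasureTheory

/-- Along generic points, small group elements carry `θ x₀` to `θ x` for points `x` that escape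
from every closed set `D n` on which the relations are nowhere dense; in the limit a point outside
all `D n` is mapped into the orbit of `θ x₀`. -/
theorem exists_mem_orbit_notMem {X : Type*} [TopologicalSpace X] [PolishSpace X]
    [MeasurableSpace X] [BorelSpace X] {E D : ℕ → SetRel X X}
    (hE : ∀ n, IsOpenRel (E n)) (hEG : ∀ n, IsGδ (E n)) (hrefl : ∀ n x, (x, x) ∈ E n)
    (hloc : ∀ n x, ∀ y ∈ fiber (E n) x, ∀ v ∈ 𝓝 y, ∃ w ∈ 𝓝 y,
      SetRel.image (E n) w ∩ SetRel.image (E n) (fiber (E n) x) ⊆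
        SetRel.image (E n) (v ∩ fiber (E n) x))
    (hD : ∀ n, IsClosed (D n))
    (hdiff : ∀ n, ∃ C ∈ residual X, ∀ x ∈ C, ∀ y ∈ C, ∃ s,
      fiber (E s) y ⊆ closure (fiber (E s) y \ fiber (D n) x))
    [Nonempty X]
    {G : Type*} [Group G] [TopologicalSpace G] [IsTopologicalGroup G] [PolishSpace G]
    {Y : Type*} [TopologicalSpace Y] [PolishSpace Y] [MeasurableSpace Y] [BorelSpace Y]
    [MulAction G Y] [ContinuousSMul G Y]
    {θ : X → Y} (hθ : Measurable θ) (hom : ∀ n x y, (x, y) ∈ E n → ∃ g : G, g • θ y = θ x) :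
    ∃ x y, (∃ g : G, g • θ x = θ y) ∧ ∀ n, (x, y) ∉ D n := by
  obtain ⟨K, hKo, hKd, hKc⟩ := exists_continuousOn_iInter_dense hθ
  obtain ⟨W, hW⟩ := (𝓝 (1 : G)).exists_antitone_basis
  choose C hC hCd using hdiff
  obtain ⟨M, hM, hMP, hMM⟩ := exists_hereditary hE
    (P := fun x => (∀ n, x ∈ C n) ∧ (∀ n, x ∈ K n) ∧ ∀ k s,
      ∀ᶠ z : fiber (E s) x in residual (fiber (E s) x), ∃ O ∈ 𝓝 x,
        ∀ᶠ y : fiber (E s) z in residual (fiber (E s) z),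
          (y : X) ∈ O → ∃ w ∈ W k, θ y = w • θ x)
    ((eventually_countable_forall.2 hC).and
      ((eventually_countable_forall.2 fun n => residual_of_dense_open (hKo n) (hKd n)).and
        (eventually_countable_forall.2 fun k => eventually_countable_forall.2 fun s =>
          eventually_exists_smul_eq (hE s) (hEG s) hθ (hom s) (hW.1.mem_of_mem trivial))))
  obtain ⟨x₀, hx₀⟩ := (dense_of_mem_residual hM).nonempty
  let := upgradeIsCompletelyMetrizable X
  let := upgradeIsCompletelyMetrizable G
  let F : ℕ → Set X := fun n => {y | (x₀, y) ∉ D n}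
  have hF : ∀ n, IsOpen (F n) := fun n =>
    (hD n).isOpen_compl.preimage (f := fun y => (x₀, y)) (by fun_prop)
  have hstep : ∀ (n : ℕ) (x : X) (h : G) (O : Set X), x ∈ M → θ x = h • θ x₀ → IsOpen O → x ∈ O →
      ∃ (x' : X) (h' : G) (O' : Set X), (x' ∈ M ∧ θ x' = h' • θ x₀ ∧ IsOpen O' ∧ x' ∈ O') ∧
        Dist.dist h h' ≤ 1 / 2 / 2 ^ n ∧ closure O' ⊆ O ∩ K n ∩ F n ∧
        O' ⊆ Metric.ball x' (1 / 2 / 2 ^ n) := by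
    intro n x h O hx hxh hO hxO
    have hε : (0 : ℝ) < 1 / 2 / 2 ^ n := by positivity
    -- The complete metric on `G` need not be invariant, so the size of `w` is chosen after `h`.
    have hmul : ∀ᶠ w in 𝓝 (1 : G), Dist.dist h (w * h) ≤ 1 / 2 / 2 ^ n := by
      have : Tendsto (fun w : G => w * h) (𝓝 1) (𝓝 h) := by
        simpa using (continuous_mul_const h).tendsto (1 : G)
      filter_upwards [this.eventually (Metric.ball_mem_nhds h hε)] with w hw
      rw [dist_comm]
      exact (Metric.mem_ball.1 hw).le
    obtain ⟨k, -, hk⟩ := hW.1.mem_iff.1 hmul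
    obtain ⟨s, hs⟩ := hCd n x₀ ((hMP _ hx₀).1 n) x ((hMP _ hx).1 n)
    have hs' : fiber (E s) x ⊆ closure (fiber (E s) x ∩ F n) := hs
    have hgen := ((hMP _ hx).2.2 k s).and ((hMM x hx s).and
      (eventually_mem_closure_fiber_inter (hE s) (hrefl s x) (hloc s x) (hF n) hs'))
    -- Go from `x` to the new point through `z`: this `z` need not be close to `x`, but `E_s(z) ∩ F
    -- n` returns arbitrarily near `x`.
    obtain ⟨z, hz, -, ⟨O₁, hO₁, hzθ⟩, hzM, hzx⟩ := nonempty_inter_of_eventually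
      (P := fun z => (∃ O ∈ 𝓝 x, ∀ᶠ y : fiber (E s) z in residual (fiber (E s) z),
          (y : X) ∈ O → ∃ w ∈ W k, θ y = w • θ x) ∧ z ∈ M ∧ x ∈ closure (fiber (E s) z ∩ F n))
      (isGδ_fiber (hEG s) x) hgen isOpen_univ ⟨x, hrefl s x, trivial⟩
    obtain ⟨O₂, hO₂, hO₂o, hxO₂⟩ := mem_nhds_iff.1 hO₁
    obtain ⟨p, hp, hpz, hpF⟩ := mem_closure_iff.1 hzx (O ∩ O₂) (hO.inter hO₂o) ⟨hxO, hxO₂⟩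
    obtain ⟨y, hyz, ⟨⟨hyO, hyO₂⟩, hyF⟩, hyθ, hyM⟩ := nonempty_inter_of_eventually
      (P := fun y => (y ∈ O₁ → ∃ w ∈ W k, θ y = w • θ x) ∧ y ∈ M)
      (isGδ_fiber (hEG s) z) (hzθ.and (hMM z hzM s)) ((hO.inter hO₂o).inter (hF n))
      ⟨p, hpz, hp, hpF⟩
    obtain ⟨w, hw, hwy⟩ := hyθ (hO₂ hyO₂)
    have hnhds : O ∩ K n ∩ F n ∩ Metric.ball y (1 / 2 / 2 ^ n) ∈ 𝓝 y :=
      (((hO.inter (hKo n)).inter (hF n)).inter Metric.isOpen_ball).mem_nhds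
        ⟨⟨⟨hyO, (hMP _ hyM).2.1 n⟩, hyF⟩, Metric.mem_ball_self hε⟩
    obtain ⟨t, ht, htc, hts⟩ := exists_mem_nhds_isClosed_subset hnhds
    have hcl : closure (interior t) ⊆ t := closure_minimal interior_subset htc
    exact ⟨y, w * h, interior t,
      ⟨hyM, by rw [hwy, hxh, smul_smul], isOpen_interior, mem_interior_iff_mem_nhds.2 ht⟩,
      hk hw, fun q hq => (hts (hcl hq)).1, fun q hq => (hts (interior_subset hq)).2⟩
  let T := {q : X × G × Set X //
    q.1 ∈ M ∧ θ q.1 = q.2.1 • θ x₀ ∧ IsOpen q.2.2 ∧ q.1 ∈ q.2.2}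
  have hstep' : ∀ (n : ℕ) (q : T), ∃ q' : T,
      Dist.dist q.1.2.1 q'.1.2.1 ≤ 1 / 2 / 2 ^ n ∧
      closure q'.1.2.2 ⊆ q.1.2.2 ∩ K n ∩ F n ∧
      q'.1.2.2 ⊆ Metric.ball q'.1.1 (1 / 2 / 2 ^ n) := by
    rintro n ⟨⟨x, h, O⟩, h₁, h₂, h₃, h₄⟩
    obtain ⟨x', h', O', hq, hrest⟩ := hstep n x h O h₁ h₂ h₃ h₄
    exact ⟨⟨(x', h', O'), hq⟩, hrest⟩
  choose next hnext using hstep'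
  let q : ℕ → T := fun n => Nat.rec
    ⟨(x₀, 1, univ), hx₀, (one_smul G (θ x₀)).symm, isOpen_univ, mem_univ _⟩ next n
  have hq : ∀ n, q (n + 1) = next n (q n) := fun n => rfl
  let O : ℕ → Set X := fun n => (q n).1.2.2
  let x : ℕ → X := fun n => (q n).1.1
  let h : ℕ → G := fun n => (q n).1.2.1
  have hOsub : ∀ n, closure (O (n + 1)) ⊆ O n ∩ K n ∩ F n := fun n => (hnext n (q n)).2.1
  have hOanti : Antitone O := antitone_nat_of_succ_le fun n =>
    subset_closure.trans ((hOsub n).trans fun _ hy => hy.1.1)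
  have hxO : ∀ n m, n ≤ m → x m ∈ O n := fun n m hnm => hOanti hnm (q m).2.2.2.2
  have hball : ∀ n, O (n + 1) ⊆ Metric.ball (x (n + 1)) (1 / 2 / 2 ^ n) := fun n =>
    (hnext n (q n)).2.2
  obtain ⟨h', hh'⟩ := cauchySeq_tendsto_of_complete
    (cauchySeq_of_le_geometric_two (f := h) (C := 1) fun n => (hnext n (q n)).1)
  have hxc : CauchySeq fun n => x (n + 1) := by
    refine cauchySeq_of_le_geometric_two (C := 1) fun n => ?_
    rw [dist_comm]
    exact (hball n (hxO (n + 1) (n + 2) (by omega))).le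
  -- The sequence is shifted because the initial neighbourhood `univ` has no radius bound.
  obtain ⟨y, hy⟩ := cauchySeq_tendsto_of_complete hxc
  rw [tendsto_add_atTop_iff_nat (f := x) 1] at hy
  have hyO : ∀ n, y ∈ O n ∩ K n ∩ F n := fun n => hOsub n <|
    mem_closure_of_tendsto hy ((eventually_ge_atTop (n + 1)).mono fun m hm => hxO _ _ hm)
  have hyK : y ∈ ⋂ n, K n := mem_iInter.2 fun n => (hyO n).1.2
  have hθy : Tendsto (fun n => θ (x n)) atTop (𝓝 (θ y)) :=
    (hKc y hyK).tendsto.comp (tendsto_nhdsWithin_iff.2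
      ⟨hy, Eventually.of_forall fun n => mem_iInter.2 (hMP _ (q n).2.1).2.1⟩)
  have hθh : Tendsto (fun n => θ (x n)) atTop (𝓝 (h' • θ x₀)) := by
    have : (fun n => θ (x n)) = fun n => h n • θ x₀ := funext fun n => (q n).2.2.1
    rw [this]
    exact hh'.smul_const _
  exact ⟨x₀, y, ⟨h', tendsto_nhds_unique hθh hθy⟩, fun n => (hyO n).2⟩

end Construction

/-! ### Composition of scales. -/

section ScaleFamily

variable {X : Type*} {U : ℝ → ℝ → SetRel X X}

namespace IsScaleFamily

variable (hU : IsScaleFamily U)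
include hU

theorem refl {R r : ℝ} (hR : 0 < R) (hr : 0 < r) (x : X) : (x, x) ∈ U R r :=
  (hU.iInter_eq_diagonal x x).2 rfl R hR r hr

theorem mono {R r s : ℝ} (hR : 0 < R) (hr : 0 < r) (hrs : r ≤ s) : U R r ⊆ U R s := by
  intro p hp
  obtain rfl | h := hrs.eq_or_lt
  · exact hp
  · exact (hU.eq_iUnion R hR s (hr.trans h) p).2 ⟨r, hr, h, hp⟩

theorem relE_mono {r s : ℝ} (hr : 0 < r) (hrs : r ≤ s) : relE U r ⊆ relE U s :=
  fun _ hp R hR => hU.mono hR hr hrs (hp R hR)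

/-- Apply the `φ` axiom twice. Monotonicity of `φ` makes `S = φ (φ R t) t` work for every splitting
of `t`, so both endpoints may be perturbed by an `a` chosen after `S`. -/
theorem exists_comp₃ {R t : ℝ} (hR : 0 < R) (ht : 0 < t) : ∃ S > 0, ∀ a > 0, ∀ s > 0,
    a + s + a = t → ∀ x x' y' y, (x, x') ∈ U S a → (x', y') ∈ U S s → (y', y) ∈ U S a →
      (x, y) ∈ U R t := by
  obtain ⟨φ, hφ, hmono, hc⟩ := hU.exists_phi
  have h₁ := hφ R hR t ht
  have hp₁ : 0 < φ R t := hR.trans_le h₁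
  have h₂ := hφ _ hp₁ t ht
  have hp₂ : 0 < φ (φ R t) t := hp₁.trans_le h₂
  refine ⟨φ (φ R t) t, hp₂, fun a ha s hs hast x x' y' y hx hxy hy => ?_⟩
  have hle : φ (φ R t) (s + a) ≤ φ (φ R t) t :=
    hmono _ hp₁ _ hp₁ _ (by positivity) _ ht le_rfl (by linarith)
  have hp₃ : 0 < φ (φ R t) (s + a) := hp₁.trans_le (hφ _ hp₁ _ (by positivity))
  have hxy' : (x, y') ∈ U (φ R t) (s + a) :=
    hc _ hp₁ s hs a ha x x' y' (hU.anti _ hp₃ _ hp₂ hle a ha hx)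
      (hU.anti _ hp₃ _ hp₂ hle s hs hxy)
  have hast' : a + (s + a) = t := by linarith
  have := hc R hR a ha (s + a) (by positivity) x y' y
  rw [hast'] at this
  exact this hxy' (hU.anti _ hp₁ _ hp₂ h₂ a ha hy)

end IsScaleFamily

/-- The relation `d(x, y) ≤ r`. -/
def relLE (U : ℝ → ℝ → SetRel X X) (r : ℝ) : SetRel X X :=
  {p | ∀ s > r, p ∈ relE U s}

end ScaleFamily

/-! ### Descriptive complexity and openness of the metric relations. -/

section Topology

variable {X : Type*} [UniformSpace X] {U : ℝ → ℝ → SetRel X X}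

theorem fiber_mem_nhds
    (hb : (𝓤 X).HasBasis (fun p : ℝ × ℝ => 0 < p.1 ∧ 0 < p.2) (fun p => U p.1 p.2))
    {R r : ℝ} (hR : 0 < R) (hr : 0 < r) (x : X) : fiber (U R r) x ∈ 𝓝 x :=
  UniformSpace.ball_mem_nhds x (hb.mem_of_mem (i := (R, r)) ⟨hR, hr⟩)

/-- Membership in `U S t` already holds at some `s < t`; the slack, halved between the endpoints,
puts points of `E_t` in the interior of each `U (n + 1) t`. -/
theorem IsScaleFamily.isGδ_relE (hU : IsScaleFamily U)
    (hb : (𝓤 X).HasBasis (fun p : ℝ × ℝ => 0 < p.1 ∧ 0 < p.2) (fun p => U p.1 p.2))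
    {t : ℝ} (ht : 0 < t) : IsGδ (relE U t) := by
  have h : relE U t = ⋂ n : ℕ, interior (U (n + 1) t) := by
    ext ⟨x, y⟩
    rw [mem_iInter]
    constructor
    · intro hxy n
      obtain ⟨S, hS, hcomp⟩ := hU.exists_comp₃ (R := n + 1) (by positivity) ht
      obtain ⟨s, hs, hst, hxys⟩ := (hU.eq_iUnion S hS t ht _).1 (hxy S hS)
      have ha : 0 < (t - s) / 2 := by linarith
      rw [mem_interior_iff_mem_nhds]
      filter_upwards [prod_mem_nhds (fiber_mem_nhds hb hS ha x) (fiber_mem_nhds hb hS ha y)]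
        with p hp
      exact hcomp _ ha s hs (by ring) p.1 x y p.2 (hU.symm _ hS _ ha _ _ hp.1) hxys hp.2
    · intro hxy R hR
      obtain ⟨n, hn⟩ := exists_nat_ge R
      exact hU.anti R hR (n + 1) (by positivity) (by linarith) t ht (interior_subset (hxy n))
  rw [h]
  exact IsGδ.iInter_of_isOpen fun n => isOpen_interior

theorem IsScaleFamily.isClosed_relLE (hU : IsScaleFamily U)
    (hb : (𝓤 X).HasBasis (fun p : ℝ × ℝ => 0 < p.1 ∧ 0 < p.2) (fun p => U p.1 p.2))
    {r : ℝ} (hr : 0 ≤ r) : IsClosed (relLE U r) := by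
  rw [← closure_subset_iff_isClosed]
  rintro ⟨x, y⟩ hxy t ht R hR
  obtain ⟨S, hS, hcomp⟩ := hU.exists_comp₃ hR (hr.trans_lt ht)
  -- One third for each endpoint, and one third to exceed `r` strictly in the middle.
  have ha : 0 < (t - r) / 3 := by linarith
  obtain ⟨p, hp, hpr⟩ := mem_closure_iff_nhds.1 hxy _
    (prod_mem_nhds (fiber_mem_nhds hb hS ha x) (fiber_mem_nhds hb hS ha y))
  exact hcomp _ ha (r + (t - r) / 3) (by linarith) (by ring) x p.1 p.2 y hp.1
    (hpr _ (by linarith) S hS) (hU.symm _ hS _ ha _ _ hp.2)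

theorem IsScaleFamily.isOpenRel_relE (hU : IsScaleFamily U)
    (hb : (𝓤 X).HasBasis (fun p : ℝ × ℝ => 0 < p.1 ∧ 0 < p.2) (fun p => U p.1 p.2))
    (hT : IsTopCompatible U) {s : ℝ} (hs : 0 < s) : IsOpenRel (relE U s) := by
  refine ⟨fun x y h R hR => hU.symm R hR s hs x y (h R hR), fun v hv => ?_⟩
  rw [isOpen_iff_mem_nhds]
  rintro y ⟨x, hxv, hxy⟩
  obtain ⟨⟨R, r⟩, ⟨hR, hr⟩, hsub⟩ :=
    (nhds_basis_uniformity' hb (x := x)).mem_iff.1 (hv.mem_nhds hxv)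
  obtain ⟨T, hT, t, ht, h⟩ := hT.open_image R hR r hr s hs x y hxy
  filter_upwards [fiber_mem_nhds hb hT ht y] with y' hy'
  obtain ⟨x', hx', hxy'⟩ := h hy'
  exact ⟨x', hsub hx', hxy'⟩

end Topology

end MetricRel

theorem propositionp {X : Type*} [UniformSpace X] (U : ℝ → ℝ → SetRel X X)
    (h₁ : MetricRel.IsScaleFamily U)
    (hbasis : (𝓤 X).HasBasis (fun p : ℝ × ℝ => 0 < p.1 ∧ 0 < p.2) (fun p => U p.1 p.2))
    (h₂ : MetricRel.IsTopCompatible U)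
    (h₃ : MetricRel.IsTurbulentFamily U)
    (h₄ : MetricRel.HasDenseDifferences U)
    {G : Type*} [Group G] [TopologicalSpace G] [IsTopologicalGroup G] [PolishSpace G]
    {Y : Type*} [TopologicalSpace Y] [PolishSpace Y] [MulAction G Y] [ContinuousSMul G Y] :
    ¬ MetricRel.BorelReducible (MetricRel.distSetoid U h₁) (MulAction.orbitRel G Y) := by
  rintro ⟨θ, hθ, hmeas, hinj⟩
  have := h₂.polish
  obtain ⟨a, -⟩ := h₃.exists_not_rel
  have : Nonempty X := ⟨a⟩
  borelize X Y
  have hpos : ∀ n : ℕ, (0 : ℝ) < n + 1 := fun n => by positivity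
  obtain ⟨x, y, ⟨g, hg⟩, hxy⟩ := MetricRel.exists_mem_orbit_notMem
    (E := fun n => MetricRel.relE U (n + 1)) (D := fun n => MetricRel.relLE U n) (G := G)
    (fun n => h₁.isOpenRel_relE hbasis h₂ (hpos n))
    (fun n => h₁.isGδ_relE hbasis (hpos n))
    (fun n x R hR => h₁.refl hR (hpos n) x)
    (fun n => h₂.local_image _ (hpos n) _ (hpos n))
    (fun n => h₁.isClosed_relLE hbasis n.cast_nonneg)
    -- Since `d ≤ n` implies membership in `E_{n+1}`, the density of `E_s(y) \ E_{n+1}(x)` passes to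
    -- the larger complement of the closed relation.
    (fun n => by
      obtain ⟨C, hC, h⟩ := h₄ (n + 1) (hpos n)
      refine ⟨C, hC, fun x hx y hy => ?_⟩
      obtain ⟨s₀, -, hs⟩ := h x hx y hy
      obtain ⟨s, hss⟩ := exists_nat_ge s₀
      refine ⟨s, (hs (s + 1) (by linarith)).trans (closure_mono ?_)⟩
      exact sdiff_subset_sdiff_right fun z hz => hz _ (by linarith))
    hmeas
    (fun n x y h => hθ x y ((MetricRel.dist_lt_top_iff U x y).2 ⟨_, hpos n, h⟩))
  have hrel : MetricRel.distSetoid U h₁ y x :=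
    Quotient.exact (@hinj ⟦y⟧ ⟦x⟧ (Quotient.sound (⟨g, hg⟩ : MulAction.orbitRel G Y _ _)))
  obtain ⟨r, hr, h⟩ := (MetricRel.dist_lt_top_iff U x y).1 ((MetricRel.distSetoid U h₁).symm hrel)
  obtain ⟨n, hn⟩ := exists_nat_ge r
  -- A finite distance would place the pair in some relation `d ≤ n`, all of which it escapes.
  exact hxy n fun s hs => h₁.relE_mono hr (hn.trans hs.le) h
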